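/- There is an absolute constant $C>0$ such that the following holds for every $n\ge 1$, every two vertices $s,t\in\{1,\dots,n\}$ and every integer $d\ge 0$. Let $N=\binom n2$, and let a simple undirected graph $G$ on $\{1,\dots,n\}$ be given by its adjacency matrix, i.e. by a string $z\in\{0,1\}^N$ with $z_{uv}=1$ iff $uv$ is an edge of $G$. Consider the $st$-connectivity problem (decide whether $G$ contains a path from $s$ to $t$) under the promise that, if $s$ and $t$ are connected in $G$, then they are connected by a path of length at most $d$. (1) There is a quantum query algorithm that makes at most $C\,n\sqrt d$, and also at most $C\sqrt{Nd}$, queries and that, on every input $z$ satisfying the promise, outputs the correct answer with probability at least $2/3$. Here a quantum query algorithm making $T$ queries has an index register with basis $0,1,\dots,N$ (identifying $1,\dots,N$ with the pairs $uv$), a value qubit, and a finite-dimensional workspace containing an output qubit; it starts in the state $|0\rangle|0\rangle|0\rangle$, applies $U_0,O_z,U_1,O_z,\dots,O_z,U_T$, where the unitaries $U_i$ do not depend on $z$, the oracle $O_z\colon |j\rangle|v\rangle|w\rangle\mapsto|j\rangle|v\oplus z_j\rangle|w\rangle$ (with $z_0=0$) is used $T$ times, and finally measures the output qubit. (2) If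 $s\neq t$, there is a span program that evaluates this problem on all inputs satisfying the promise, with positive witness size at most $d$ and negative witness size at most $C n^2$. Here a span program consists of a non-zero target vector $\tau\in\mathbb R^m$ and a finite family of input vectors $v_i\in\mathbb R^m$, $i\in I$, each labelled by an input variable $j$ and a bit $b$; $v_i$ is available on input $z$ if $z_j=b$, and the program evaluates to $1$ on $z$ if $\tau$ is in the span of the available input vectors, and to $0$ otherwise. Positive witness size at most $W$ means that, for each promised $z$ on which the program evaluates to $1$, there is $w\in\mathbb R^I$ vanishing at all $i$ for which $v_i$ is not available, with $\tau=\sum_i w_iv_i$ and $\sum_i w_i^2\le W$. Negative witness size at most $W$ means that, for each promised $z$ on which the program evaluates to $0$, there is $w'\in\mathbb R^m$ orthogonal to all available $v_i$, with $\langle\tau,w'\rangle=1$ and $\sum_i\langle v_i,w'\rangle^2\le W$. -/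

import Mathlib

/-! ### Quantum query algorithms with Boolean input variables indexed by `X` -/

/-- Classical basis states of a query algorithm: the index register (`none` is the dummy index `0`),
the value qubit, and the workspace, which consists of the output qubit and a register `S`. -/
abbrev QBasis (X S : Type) : Type := Option X × Bool × (Bool × S)

/-- The input string, extended by the dummy variable `z₀ = 0`. -/
def extendInput {X : Type} (z : X → Bool) : Option X → Bool
  | none => false
  | some j => z j

/-- The action of the input oracle on basis states: `|j⟩|v⟩|w⟩ ↦ |j⟩|v + z_j⟩|w⟩` (mod 2). -/
def oracleMap {X S : Type} (z : X → Bool) (b : QBasis X S) : QBasis X S :=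
  (b.1, xor b.2.1 (extendInput z b.1), b.2.2)

/-- The input oracle `O_z` as a matrix; its column at `b` is the basis vector at `oracleMap z b`. -/
def oracle {X S : Type} [DecidableEq X] [DecidableEq S] (z : X → Bool) :
    Matrix (QBasis X S) (QBasis X S) ℂ :=
  Matrix.of fun b' b => if b' = oracleMap z b then 1 else 0

/-- A quantum query algorithm `U₀ → O_z → U₁ → O_z → ⋯ → O_z → U_T` making `T = queries` queries.
The unitaries do not depend on the input; those with index larger than `queries` are never used. -/
structure QueryAlgorithm (X : Type) [Fintype X] [DecidableEq X] where
  /-- the basis of the part of the workspace other than the output qubit -/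
  S : Type
  [fintypeS : Fintype S]
  [decEqS : DecidableEq S]
  /-- the initial basis state of that part of the workspace -/
  start : S
  /-- the number of queries -/
  queries : ℕ
  /-- the unitaries applied between the queries -/
  U : ℕ → Matrix.unitaryGroup (QBasis X S) ℂ

namespace QueryAlgorithm

attribute [instance] QueryAlgorithm.fintypeS QueryAlgorithm.decEqS

variable {X : Type} [Fintype X] [DecidableEq X] (A : QueryAlgorithm X)

/-- The state after `k` queries and the unitary `U_k`; the initial state is `|0⟩|0⟩|0⟩`. -/
noncomputable def state (z : X → Bool) : ℕ → QBasis X A.S → ℂ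
  | 0 => Matrix.mulVec (A.U 0 : Matrix (QBasis X A.S) (QBasis X A.S) ℂ)
      (Pi.single (none, false, (false, A.start)) 1)
  | k + 1 => Matrix.mulVec (A.U (k + 1) : Matrix (QBasis X A.S) (QBasis X A.S) ℂ)
      (Matrix.mulVec (oracle z) (state z k))

/-- The probability that measuring the output qubit at the end of the computation gives `o`. -/
noncomputable def outputProb (z : X → Bool) (o : Bool) : ℝ :=
  ∑ b : QBasis X A.S, if b.2.2.1 = o then ‖A.state z A.queries b‖ ^ 2 else 0

/-- The algorithm evaluates, with error at most `1/3`, the partial function that is defined on `D`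
and agrees there with `f`. -/
def Evaluates (D : Set (X → Bool)) (f : (X → Bool) → Bool) : Prop :=
  ∀ z ∈ D, 2 / 3 ≤ A.outputProb z (f z)

end QueryAlgorithm

/-! ### Span programs -/

/-- A span program over Boolean input variables indexed by `X`. The input vector `vec i` is labelled
by the input variable `(label i).1` and its value `(label i).2`. -/
structure SpanProgram (X : Type) where
  /-- the dimension of the vector space -/
  dim : ℕ
  /-- the target vector -/
  target : EuclideanSpace ℝ (Fin dim)
  target_ne_zero : target ≠ 0
  /-- the index set of the input vectors -/
  I : Type
  [fintypeI : Fintype I]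
  /-- the input vectors -/
  vec : I → EuclideanSpace ℝ (Fin dim)
  /-- the labels of the input vectors -/
  label : I → X × Bool

namespace SpanProgram

attribute [instance] SpanProgram.fintypeI

variable {X : Type} (P : SpanProgram X)

/-- The input vector with index `i` is available on input `z`. -/
def Available (z : X → Bool) (i : P.I) : Prop :=
  z (P.label i).1 = (P.label i).2

/-- The program evaluates to `1` on `z`. -/
def Accepts (z : X → Bool) : Prop :=
  P.target ∈ Submodule.span ℝ (P.vec '' {i | P.Available z i})

/-- The program evaluates the partial function that is defined on `D` and agrees there with `f`. -/
def Evaluates (D : Set (X → Bool)) (f : (X → Bool) → Bool) : Prop :=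
  ∀ z ∈ D, f z = true ↔ P.Accepts z

/-- `w` is a positive witness for the input `z`; its size is `∑ i, w i ^ 2`. -/
def IsPositiveWitness (z : X → Bool) (w : P.I → ℝ) : Prop :=
  P.target = ∑ i, w i • P.vec i ∧ ∀ i, ¬ P.Available z i → w i = 0

/-- `w` is a negative witness for the input `z`; its size is `∑ i, ⟪vec i, w⟫ ^ 2`. -/
def IsNegativeWitness (z : X → Bool) (w : EuclideanSpace ℝ (Fin P.dim)) : Prop :=
  inner ℝ P.target w = 1 ∧ ∀ i, P.Available z i → inner ℝ (P.vec i) w = 0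

/-- Every input of `D` on which `P` evaluates to `1` has a positive witness of size at most `W`. -/
def PositiveWitnessSizeLE (D : Set (X → Bool)) (W : ℝ) : Prop :=
  ∀ z ∈ D, P.Accepts z → ∃ w : P.I → ℝ, P.IsPositiveWitness z w ∧ ∑ i, w i ^ 2 ≤ W

/-- Every input of `D` on which `P` evaluates to `0` has a negative witness of size at most `W`. -/
def NegativeWitnessSizeLE (D : Set (X → Bool)) (W : ℝ) : Prop :=
  ∀ z ∈ D, ¬ P.Accepts z → ∃ w : EuclideanSpace ℝ (Fin P.dim),
    P.IsNegativeWitness z w ∧ ∑ i, (inner ℝ (P.vec i) w) ^ 2 ≤ W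

end SpanProgram

/-! ### The `st`-connectivity problem -/

/-- The input variables: the `n.choose 2` entries of the adjacency matrix above the diagonal, indexed
by the unordered pairs of distinct vertices. -/
abbrev EdgeVar (n : ℕ) : Type := {e : Sym2 (Fin n) // ¬ e.IsDiag}

/-- The simple graph with adjacency matrix `z`: `u` and `v` are adjacent iff `u ≠ v` and
`z_{uv} = 1`. -/
def inputGraph {n : ℕ} (z : EdgeVar n → Bool) : SimpleGraph (Fin n) :=
  SimpleGraph.fromEdgeSet {e | ∃ h : ¬ e.IsDiag, z ⟨e, h⟩ = true}

open Classical in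
/-- The function to be computed: is there a path from `s` to `t`? -/
noncomputable def stConnectivity {n : ℕ} (s t : Fin n) (z : EdgeVar n → Bool) : Bool :=
  decide ((inputGraph z).Reachable s t)

/-- The promise: if `s` and `t` are connected, then by a path of length at most `d`. -/
def shortPathPromise {n : ℕ} (s t : Fin n) (d : ℕ) : Set (EdgeVar n → Bool) :=
  {z | (inputGraph z).Reachable s t →
    ∃ p : (inputGraph z).Walk s t, p.IsPath ∧ p.length ≤ d}

/-!
The span program is the usual one: the target is `e_s - e_t`, and the pair `uv` contributes the vector
`e_u - e_v`, available if `uv` is an edge. A path from `s` to `t` of length `ℓ` is a positive witness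
of size `ℓ` (`exists_flow_of_isTrail`), and if `s` and `t` are not connected, the indicator function
of the component of `s` is a negative witness of size at most `n.choose 2`
(`stProgram_exists_isNegativeWitness`).

The algorithm works on `ℂ^(Option X)`, where `X` indexes the variables and hence the input vectors,
and `none` stands for the target. Let `K` be the space of linear relations between the target and the
suitably scaled input vectors, `R` the reflection about `K`, `R_z` the reflection that negates the
basis vectors of the unavailable inputs, and `U = R R_z`. One application of `U` costs one query, by
phase kickback. The algorithm measures whether the time average `(1/T) ∑ₘ U^m e` of `e = e_none` is
large. A positive witness gives a vector of `K` fixed by `R_z`, hence by `U`, that overlaps `e` by a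
constant, so the average is large (`norm_inner_le_norm_sum_iterate`). A negative witness gives
`y ⊥ K` whose available part is `e`; then `2e = y + R_z y`, and since `R y = -y` this is
`R_z y - U (R_z y)`. The sum telescopes, and the average has norm at most `‖y‖ / T`
(`norm_sum_iterate_le_of_coboundary`). This replaces the spectral gap and phase estimation of
the customary argument. With `‖y‖² ≤ 1 + 2 W₁ W₀`, where `W₁` and `W₀` bound the positive and negative
witness sizes, `T` of the order of `√(W₁ W₀)` suffices.

The average is computed with a clock register in uniform superposition over `T` values. The walk
belonging to the clock value `k` starts only after `k` queries; until then the index register holds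
the dummy index, on which a query acts trivially (`clockedWalkMatrix_mulVec`), so no controlled
queries are needed. A final unitary flips the output qubit if the clock is uniform
(`uniformTest_mulVec_clockState`).
-/

/-! ### Unitary matrices and linear isometries -/

open Matrix in
/-- A vector of norm `1` is the image of any given basis vector under some unitary matrix. -/
lemma exists_unitary_mulVec_single {B : Type} [Fintype B] [DecidableEq B] (i : B) (b : B → ℂ)
    (hb : ∑ j, ‖b j‖ ^ 2 = 1) :
    ∃ M : unitaryGroup B ℂ, (M : Matrix B B ℂ) *ᵥ Pi.single i 1 = b := by
  have hnorm : ‖WithLp.toLp 2 b‖ = 1 := by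
    rw [EuclideanSpace.norm_eq, hb, Real.sqrt_one]
  have hon : Orthonormal ℂ (({i} : Set B).domRestrict fun _ => WithLp.toLp 2 b) :=
    ⟨fun _ => hnorm, fun j k hjk => (hjk (Subsingleton.elim j k)).elim⟩
  obtain ⟨e, he⟩ := hon.exists_orthonormalBasis_extension_of_card_eq (by simp)
  refine ⟨⟨(EuclideanSpace.basisFun B ℂ).toBasis.toMatrix e,
    (EuclideanSpace.basisFun B ℂ).toMatrix_orthonormalBasis_mem_unitary e⟩, ?_⟩
  ext j
  simp [Module.Basis.toMatrix_apply, he i rfl]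

/-- The matrix, in the standard basis, of a linear isometry of `ℂ^B` onto itself. -/
noncomputable def isometryMatrix {B : Type} [Fintype B] [DecidableEq B]
    (L : EuclideanSpace ℂ B ≃ₗᵢ[ℂ] EuclideanSpace ℂ B) : Matrix.unitaryGroup B ℂ :=
  ⟨LinearMap.toMatrix (EuclideanSpace.basisFun B ℂ).toBasis
      (EuclideanSpace.basisFun B ℂ).toBasis L.toLinearEquiv,
    L.toMatrix_mem_unitaryGroup (EuclideanSpace.basisFun B ℂ) (EuclideanSpace.basisFun B ℂ)⟩

lemma isometryMatrix_mulVec {B : Type} [Fintype B] [DecidableEq B]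
    (L : EuclideanSpace ℂ B ≃ₗᵢ[ℂ] EuclideanSpace ℂ B) (u : EuclideanSpace ℂ B) (i : B) :
    Matrix.mulVec (isometryMatrix L : Matrix B B ℂ) u i = L u i := by
  have h := congrFun (LinearMap.toMatrix_mulVec_repr (EuclideanSpace.basisFun B ℂ).toBasis
      (EuclideanSpace.basisFun B ℂ).toBasis (L.toLinearEquiv : _ →ₗ[ℂ] _) u) i
  have hu : ⇑((EuclideanSpace.basisFun B ℂ).toBasis.repr u) = u.ofLp := by
    ext j
    simp
  rw [hu] at h
  simpa [isometryMatrix] using h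

lemma sum_sq_norm_unitary_mulVec {B : Type} [Fintype B] [DecidableEq B]
    (M : Matrix.unitaryGroup B ℂ) (v : B → ℂ) :
    ∑ i, ‖Matrix.mulVec (M : Matrix B B ℂ) v i‖ ^ 2 = ∑ i, ‖v i‖ ^ 2 := by
  have key : ∀ w : B → ℂ, ((∑ i, ‖w i‖ ^ 2 : ℝ) : ℂ) = dotProduct (star w) w := fun w => by
    simp [dotProduct, ← Complex.normSq_eq_norm_sq, Complex.normSq_eq_conj_mul_self]
  have hM : (M : Matrix B B ℂ).conjTranspose * (M : Matrix B B ℂ) = 1 :=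
    Matrix.UnitaryGroup.star_mul_self M
  have : ((∑ i, ‖Matrix.mulVec (M : Matrix B B ℂ) v i‖ ^ 2 : ℝ) : ℂ)
      = ((∑ i, ‖v i‖ ^ 2 : ℝ) : ℂ) := by
    rw [key, key, Matrix.star_mulVec, Matrix.dotProduct_mulVec, Matrix.vecMul_vecMul, hM,
      Matrix.vecMul_one]
  exact_mod_cast this

lemma blockDiagonal_mem_unitaryGroup {B o : Type} [Fintype B] [DecidableEq B] [Fintype o]
    [DecidableEq o] (M : o → Matrix.unitaryGroup B ℂ) :
    Matrix.blockDiagonal (fun c => (M c : Matrix B B ℂ)) ∈ Matrix.unitaryGroup (B × o) ℂ := by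
  rw [Matrix.mem_unitaryGroup_iff', Matrix.star_eq_conjTranspose,
    Matrix.blockDiagonal_conjTranspose, ← Matrix.blockDiagonal_mul, ← Matrix.blockDiagonal_one]
  congr 1
  ext1 c
  exact Matrix.UnitaryGroup.star_mul_self (M c)

lemma blockDiagonal_mulVec_apply {B o : Type} [Fintype B] [Fintype o] [DecidableEq o]
    (M : o → Matrix B B ℂ) (v : B × o → ℂ) (x : B) (c : o) :
    Matrix.mulVec (Matrix.blockDiagonal M) v (x, c) = Matrix.mulVec (M c) (fun y => v (y, c)) x := by
  simp [Matrix.mulVec, dotProduct, Fintype.sum_prod_type, Matrix.blockDiagonal_apply, ite_mul]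

/-! ### Time averages of an isometry -/

section Averages

variable {E : Type*} [NormedAddCommGroup E] [InnerProductSpace ℂ E]

/-- A fixed vector `u` has the same inner product with every point of the orbit of `e`, so a large
overlap of `u` with `e` makes the time average of the orbit large. -/
lemma norm_inner_le_norm_sum_iterate (U : E ≃ₗᵢ[ℂ] E) {u : E} (hu : U u = u) (e : E) (T : ℕ) :
    T * ‖(inner ℂ u e : ℂ)‖ ≤ ‖u‖ * ‖∑ m ∈ Finset.range T, U^[m + 1] e‖ := by
  have h : ∀ m, (inner ℂ u (U^[m] e) : ℂ) = inner ℂ u e := by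
    intro m
    induction m with
    | zero => rfl
    | succ m ih =>
      rw [Function.iterate_succ_apply', ← ih]
      nth_rewrite 1 [← hu]
      exact U.inner_map_map _ _
  have hs : (inner ℂ u (∑ m ∈ Finset.range T, U^[m + 1] e) : ℂ) = T * inner ℂ u e := by
    simp only [inner_sum, h, Finset.sum_const, Finset.card_range, nsmul_eq_mul]
  calc T * ‖(inner ℂ u e : ℂ)‖ = ‖(inner ℂ u (∑ m ∈ Finset.range T, U^[m + 1] e) : ℂ)‖ := by
        rw [hs, norm_mul, Complex.norm_natCast]
    _ ≤ _ := norm_inner_le_norm _ _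

lemma norm_iterate (U : E ≃ₗᵢ[ℂ] E) (e : E) (m : ℕ) : ‖U^[m] e‖ = ‖e‖ := by
  induction m with
  | zero => rfl
  | succ m ih => rw [Function.iterate_succ_apply', U.norm_map, ih]

/-- The orbit sum of a coboundary `y - U y` telescopes, so it stays bounded. -/
lemma norm_sum_iterate_le_of_coboundary (U : E ≃ₗᵢ[ℂ] E) {e y : E} (h : (2 : ℂ) • e = y - U y)
    (T : ℕ) : ‖∑ m ∈ Finset.range T, U^[m + 1] e‖ ≤ ‖y‖ := by
  have hm : ∀ m, (2 : ℂ) • U^[m] e = U^[m] y - U^[m + 1] y := by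
    intro m
    induction m with
    | zero => exact h
    | succ m ih =>
      rw [Function.iterate_succ_apply', ← map_smul, ih, map_sub, ← Function.iterate_succ_apply' U,
        ← Function.iterate_succ_apply' U]
  have hs : (2 : ℂ) • ∑ m ∈ Finset.range T, U^[m + 1] e = U^[1] y - U^[T + 1] y := by
    rw [Finset.smul_sum, ← Finset.sum_range_sub' (fun m => U^[m + 1] y)]
    exact Finset.sum_congr rfl fun m _ => hm (m + 1)
  have h2 : ‖(2 : ℂ) • ∑ m ∈ Finset.range T, U^[m + 1] e‖ ≤ ‖y‖ + ‖y‖ := by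
    rw [hs]
    refine (norm_sub_le _ _).trans ?_
    rw [norm_iterate, norm_iterate]
  rw [norm_smul, Complex.norm_ofNat] at h2
  linarith

end Averages

/-! ### Query algorithms preserve the norm -/

lemma oracleMap_involutive {X S : Type} (z : X → Bool) :
    Function.Involutive (oracleMap (S := S) z) := by
  rintro ⟨x, v, w⟩
  simp [oracleMap]

lemma oracle_mulVec {X S : Type} [Fintype X] [DecidableEq X] [Fintype S] [DecidableEq S]
    (z : X → Bool) (ψ : QBasis X S → ℂ) (b : QBasis X S) :
    Matrix.mulVec (oracle z) ψ b = ψ (oracleMap z b) := by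
  have h : ∀ c, b = oracleMap z c ↔ c = oracleMap z b := fun c =>
    ⟨fun h => by rw [h, oracleMap_involutive], fun h => by rw [h, oracleMap_involutive]⟩
  simp [Matrix.mulVec, dotProduct, oracle, h]

namespace QueryAlgorithm

variable {X : Type} [Fintype X] [DecidableEq X] (A : QueryAlgorithm X)

lemma sum_sq_norm_state (z : X → Bool) (k : ℕ) : ∑ b, ‖A.state z k b‖ ^ 2 = 1 := by
  induction k with
  | zero =>
    rw [state, sum_sq_norm_unitary_mulVec, Finset.sum_eq_single (none, false, (false, A.start))]
    · simp
    · intro b _ hb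
      simp [hb]
    · simp
  | succ k ih =>
    rw [state, sum_sq_norm_unitary_mulVec, ← ih]
    simp only [oracle_mulVec]
    exact Equiv.sum_comp (oracleMap_involutive z).toPerm fun b => ‖A.state z k b‖ ^ 2

lemma outputProb_true_add_false (z : X → Bool) : A.outputProb z true + A.outputProb z false = 1 := by
  rw [← A.sum_sq_norm_state z A.queries, outputProb, outputProb, ← Finset.sum_add_distrib]
  refine Finset.sum_congr rfl fun b _ => ?_
  cases b.2.2.1 <;> simp

end QueryAlgorithm

/-! ### The algorithm given by two reflections -/

section Reflections

variable {X : Type} [Fintype X] [DecidableEq X]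

/-- The reflection of `ℂ^(Option X)` that fixes the basis vector `none` and the basis vectors `some x`
with `z x = 1`, and negates those with `z x = 0`. -/
noncomputable def availableReflection (z : X → Bool) :
    EuclideanSpace ℂ (Option X) ≃ₗᵢ[ℂ] EuclideanSpace ℂ (Option X) :=
  LinearIsometryEquiv.piLpCongrRight 2 fun x =>
    if x.elim true z then LinearIsometryEquiv.refl ℂ ℂ else LinearIsometryEquiv.neg ℂ

omit [DecidableEq X] in
lemma availableReflection_apply (z : X → Bool) (u : EuclideanSpace ℂ (Option X)) (x : Option X) :
    availableReflection z u x = if x.elim true z then u x else -u x := by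
  rw [availableReflection, LinearIsometryEquiv.piLpCongrRight_apply]
  split_ifs with h <;> simp [h]

variable (K : Submodule ℂ (EuclideanSpace ℂ (Option X)))

/-- The product of the reflection determined by the input and the reflection about `K`. -/
noncomputable def walkOperator (z : X → Bool) :
    EuclideanSpace ℂ (Option X) ≃ₗᵢ[ℂ] EuclideanSpace ℂ (Option X) :=
  (availableReflection z).trans K.reflection

/-- The input-independent part of `walkOperator K z`: the phase oracle contributes the sign
`(-1) ^ z_x`, which differs from the sign in `availableReflection z` by the sign in
`availableReflection 0`. -/
noncomputable def walkMatrix : Matrix.unitaryGroup (Option X) ℂ :=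
  isometryMatrix (walkOperator K fun _ => false)

lemma walkMatrix_mulVec (z : X → Bool) (u : EuclideanSpace ℂ (Option X)) (x : Option X) :
    Matrix.mulVec (walkMatrix K : Matrix (Option X) (Option X) ℂ)
      (fun y => (if extendInput z y then -1 else 1) * u y) x = walkOperator K z u x := by
  rw [walkMatrix]
  have h := isometryMatrix_mulVec (walkOperator K fun _ => false)
    (WithLp.toLp 2 fun y => (if extendInput z y then -1 else 1) * u y) x
  have hsign : availableReflection (fun _ => false)
      (WithLp.toLp 2 fun y => (if extendInput z y then -1 else 1) * u y)
      = availableReflection z u := by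
    ext y
    rw [availableReflection_apply, availableReflection_apply]
    cases y with
    | none => simp [extendInput]
    | some y => cases h : z y <;> simp [extendInput, h]
  rw [walkOperator, LinearIsometryEquiv.trans_apply, hsign] at h
  exact h

/-- The unitary applied after the `j`-th query: the walk moves for the clock values `k < j`. -/
noncomputable def clockedWalkMatrix (T j : ℕ) : Matrix.unitaryGroup (QBasis X (Fin T)) ℂ :=
  ⟨_, blockDiagonal_mem_unitaryGroup fun c : Bool × Bool × Fin T =>
    if (c.2.2 : ℕ) < j then walkMatrix K else 1⟩

/-- The state `|φ⟩ = (2T)^(-1/2) ∑ₖ |φₖ⟩(|0⟩ - |1⟩)|0⟩|k⟩`: the clock is in uniform superposition, the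
value qubit is set up for phase kickback, and the index register depends on the clock. -/
noncomputable def clockState {T : ℕ} (φ : Fin T → EuclideanSpace ℂ (Option X)) :
    QBasis X (Fin T) → ℂ :=
  fun b => if b.2.2.1 then 0
    else (if b.2.1 then -1 else 1) * ((Real.sqrt (2 * T))⁻¹ : ℝ) * φ b.2.2.2 b.1

omit [DecidableEq X] in
lemma sum_sq_norm_clockState {T : ℕ} (hT : 0 < T) (φ : Fin T → EuclideanSpace ℂ (Option X))
    (hφ : ∀ k, ‖φ k‖ = 1) : ∑ b, ‖clockState φ b‖ ^ 2 = 1 := by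
  have hφ' : ∀ k, ∑ x, ‖φ k x‖ ^ 2 = 1 := fun k => by
    rw [← EuclideanSpace.norm_sq_eq, hφ, one_pow]
  have hT' : (0 : ℝ) < 2 * T := by positivity
  have h : ∀ x : Option X, ∀ c : Bool × Bool × Fin T, ‖clockState φ (x, c)‖ ^ 2
      = if c.2.1 then 0 else (2 * T : ℝ)⁻¹ * ‖φ c.2.2 x‖ ^ 2 := by
    rintro x ⟨v, o, k⟩
    have hr : ‖(((Real.sqrt (2 * T))⁻¹ : ℝ) : ℂ)‖ ^ 2 = (2 * T : ℝ)⁻¹ := by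
      rw [Complex.norm_real, Real.norm_eq_abs, sq_abs, inv_pow, Real.sq_sqrt hT'.le]
    cases o
    · simp only [clockState, Bool.false_eq_true, if_false]
      rw [norm_mul, norm_mul, mul_pow, mul_pow, hr]
      cases v <;> simp
    · simp [clockState]
  rw [Fintype.sum_prod_type_right]
  simp only [h, Fintype.sum_prod_type, Fintype.sum_bool, if_true, Bool.false_eq_true, if_false,
    Finset.sum_const_zero, zero_add, ← Finset.mul_sum, hφ', Finset.sum_const, Finset.card_univ,
    Fintype.card_fin, nsmul_eq_mul, mul_one]
  field_simp
  norm_num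

lemma clockedWalkMatrix_mulVec {T : ℕ} (z : X → Bool) (j : ℕ) :
    Matrix.mulVec (clockedWalkMatrix K T (j + 1) : Matrix (QBasis X (Fin T)) (QBasis X (Fin T)) ℂ)
      (Matrix.mulVec (oracle z)
        (clockState fun k => (walkOperator K z)^[j - k] (EuclideanSpace.single none 1)))
    = clockState fun k => (walkOperator K z)^[j + 1 - k] (EuclideanSpace.single none 1) := by
  ext ⟨x, v, o, k⟩
  have hfun : Matrix.mulVec (oracle z)
        (clockState fun k : Fin T => (walkOperator K z)^[j - k] (EuclideanSpace.single none 1))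
      = fun b => clockState (fun k => (walkOperator K z)^[j - k] (EuclideanSpace.single none 1))
          (oracleMap z b) := funext fun b => oracle_mulVec z _ b
  rw [hfun]
  refine (blockDiagonal_mulVec_apply _ _ _ _).trans ?_
  cases o with
  | true =>
    have : (fun y : Option X => clockState
        (fun k : Fin T => (walkOperator K z)^[j - k] (EuclideanSpace.single none 1))
          (oracleMap z (y, v, true, k))) = 0 := by
      ext y
      simp [oracleMap, clockState]
    rw [this, Matrix.mulVec_zero]
    simp [clockState]
  | false =>
    -- a query multiplies the amplitude at index `y` by `(-1) ^ z_y`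
    have hφ : (fun y : Option X => clockState
        (fun k : Fin T => (walkOperator K z)^[j - k] (EuclideanSpace.single none 1))
          (oracleMap z (y, v, false, k)))
        = ((if v then -1 else 1) * (((Real.sqrt (2 * T))⁻¹ : ℝ) : ℂ)) •
          fun y => (if extendInput z y then -1 else 1) *
            ((walkOperator K z)^[j - k] (EuclideanSpace.single none 1)) y := by
      ext y
      simp only [oracleMap, clockState, Pi.smul_apply, smul_eq_mul]
      by_cases h : extendInput z y <;> cases v <;> simp [h]
    rw [hφ, Matrix.mulVec_smul, Pi.smul_apply, smul_eq_mul]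
    simp only [clockState, Bool.false_eq_true, if_false]
    congr 1
    by_cases hk : (k : ℕ) < j + 1
    · rw [if_pos hk, walkMatrix_mulVec, Nat.sub_add_comm (Nat.lt_succ_iff.1 hk),
        Function.iterate_succ_apply']
    · -- the walk has not started, and the index register still holds the dummy index
      have h1 : j - k = 0 := by omega
      have h2 : j + 1 - k = 0 := by omega
      rw [if_neg hk, h1, h2]
      cases x <;> simp [extendInput]

/-- The unitary on the output qubit and the clock that flips the output qubit if the clock is in the
uniform superposition, and does nothing on its orthogonal complement. -/
noncomputable def uniformTestMatrix (T : ℕ) : Matrix (Bool × Fin T) (Bool × Fin T) ℂ :=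
  1 - (T : ℂ)⁻¹ • Matrix.vecMulVec (fun c => if c.1 then -1 else 1) (fun c => if c.1 then -1 else 1)

lemma uniformTestMatrix_mem_unitaryGroup {T : ℕ} (hT : 0 < T) :
    uniformTestMatrix T ∈ Matrix.unitaryGroup (Bool × Fin T) ℂ := by
  have hT' : (T : ℂ) ≠ 0 := by exact_mod_cast hT.ne'
  set q : Bool × Fin T → ℂ := fun c => if c.1 then -1 else 1 with hq
  have hstar : star q = q := by
    ext ⟨o, k⟩
    cases o <;> simp [hq]
  have hqq : dotProduct q q = 2 * T := by
    simp [dotProduct, hq, Fintype.sum_prod_type, two_mul]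
  have hM : star (uniformTestMatrix T) = uniformTestMatrix T := by
    rw [uniformTestMatrix, ← hq, Matrix.star_eq_conjTranspose, Matrix.conjTranspose_sub,
      Matrix.conjTranspose_one, Matrix.conjTranspose_smul, Matrix.conjTranspose_vecMulVec, hstar]
    simp
  have hV : Matrix.vecMulVec q q * Matrix.vecMulVec q q = (2 * T : ℂ) • Matrix.vecMulVec q q := by
    rw [Matrix.vecMulVec_mul_vecMulVec, hqq]
    ext i k
    simp [Matrix.vecMulVec_apply]
    ring
  rw [Matrix.mem_unitaryGroup_iff', hM, uniformTestMatrix, ← hq, sub_mul, one_mul, mul_sub, mul_one,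
    smul_mul_smul_comm, hV, smul_smul]
  have : (T : ℂ)⁻¹ * (T : ℂ)⁻¹ * (2 * T) = (T : ℂ)⁻¹ + (T : ℂ)⁻¹ := by
    field_simp
    norm_num
  rw [this, add_smul]
  abel

/-- `uniformTestMatrix` on the output qubit and the clock, the identity on the other registers. -/
noncomputable def uniformTest (X : Type) [Fintype X] [DecidableEq X] {T : ℕ} (hT : 0 < T) :
    Matrix.unitaryGroup (QBasis X (Fin T)) ℂ :=
  ⟨Matrix.kroneckerMap (· * ·) 1 (Matrix.kroneckerMap (· * ·) 1 (uniformTestMatrix T)),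
    Matrix.kronecker_mem_unitary (one_mem _)
      (Matrix.kronecker_mem_unitary (one_mem _) (uniformTestMatrix_mem_unitaryGroup hT))⟩

lemma uniformTest_mulVec_clockState {T : ℕ} (hT : 0 < T)
    (φ : Fin T → EuclideanSpace ℂ (Option X)) (x : Option X) (v : Bool) (k : Fin T) :
    Matrix.mulVec (uniformTest X hT : Matrix (QBasis X (Fin T)) (QBasis X (Fin T)) ℂ)
      (clockState φ) (x, v, true, k)
    = (if v then -1 else 1) * ((Real.sqrt (2 * T))⁻¹ : ℝ) * ((T : ℂ)⁻¹ * (∑ l, φ l) x) := by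
  cases v <;>
    simp [Matrix.mulVec, dotProduct, uniformTest, Fintype.sum_prod_type, uniformTestMatrix,
      Matrix.one_apply, clockState, Matrix.vecMulVec_apply, ite_mul, Finset.mul_sum,
      -Fintype.sum_option, mul_left_comm]

lemma exists_prepareMatrix (X : Type) [Fintype X] [DecidableEq X] {T : ℕ} (hT : 0 < T) :
    ∃ M : Matrix.unitaryGroup (QBasis X (Fin T)) ℂ,
      Matrix.mulVec (M : Matrix (QBasis X (Fin T)) (QBasis X (Fin T)) ℂ)
        (Pi.single (none, false, (false, ⟨0, hT⟩)) 1)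
      = clockState fun _ : Fin T => EuclideanSpace.single (none : Option X) (1 : ℂ) :=
  exists_unitary_mulVec_single _ _ (sum_sq_norm_clockState hT _ fun _ => by simp)

/-- A unitary that prepares the initial clock state, in which no walk has moved. -/
noncomputable def prepareMatrix (X : Type) [Fintype X] [DecidableEq X] {T : ℕ} (hT : 0 < T) :
    Matrix.unitaryGroup (QBasis X (Fin T)) ℂ :=
  (exists_prepareMatrix X hT).choose

/-- The algorithm that averages the powers of `walkOperator K z` applied to the basis vector `none`
over a clock with `T` values, using `T` queries. -/
noncomputable def reflectionAlgorithm {T : ℕ} (hT : 0 < T) : QueryAlgorithm X where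
  S := Fin T
  start := ⟨0, hT⟩
  queries := T
  U
    | 0 => prepareMatrix X hT
    | j + 1 => if j + 1 = T then uniformTest X hT * clockedWalkMatrix K T (j + 1)
        else clockedWalkMatrix K T (j + 1)

lemma reflectionAlgorithm_state {T : ℕ} (hT : 0 < T) (z : X → Bool) {j : ℕ} (hj : j < T) :
    (reflectionAlgorithm K hT).state z j
      = clockState fun k : Fin T => (walkOperator K z)^[j - k] (EuclideanSpace.single none 1) := by
  induction j with
  | zero =>
    simp only [Nat.zero_sub, Function.iterate_zero, id_eq]
    exact (exists_prepareMatrix X hT).choose_spec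
  | succ j ih =>
    have hU : (reflectionAlgorithm K hT).U (j + 1) = clockedWalkMatrix K T (j + 1) :=
      if_neg hj.ne
    rw [QueryAlgorithm.state, ih (by omega), ← clockedWalkMatrix_mulVec, hU]
    rfl

lemma reflectionAlgorithm_state_final {T : ℕ} (hT : 0 < T) (z : X → Bool) :
    (reflectionAlgorithm K hT).state z T
      = Matrix.mulVec (uniformTest X hT : Matrix (QBasis X (Fin T)) (QBasis X (Fin T)) ℂ)
        (clockState fun k : Fin T =>
          (walkOperator K z)^[T - k] (EuclideanSpace.single none 1)) := by
  obtain ⟨j, rfl⟩ : ∃ j, T = j + 1 := ⟨T - 1, by omega⟩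
  rw [QueryAlgorithm.state, reflectionAlgorithm_state K hT z (Nat.lt_succ_self j),
    ← clockedWalkMatrix_mulVec, Matrix.mulVec_mulVec]
  simp only [reflectionAlgorithm, if_true]
  rfl

lemma reflectionAlgorithm_outputProb_true {T : ℕ} (hT : 0 < T) (z : X → Bool) :
    (reflectionAlgorithm K hT).outputProb z true
      = ‖∑ m ∈ Finset.range T, (walkOperator K z)^[m + 1] (EuclideanSpace.single none 1)‖ ^ 2
        / T ^ 2 := by
  have hsum : ∑ m ∈ Finset.range T, (walkOperator K z)^[m + 1] (EuclideanSpace.single none 1)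
      = ∑ k : Fin T, (walkOperator K z)^[T - k] (EuclideanSpace.single none 1) := by
    rw [Fin.sum_univ_eq_sum_range
      (fun k => (walkOperator K z)^[T - k] (EuclideanSpace.single none 1)),
      ← Finset.sum_range_reflect]
    refine Finset.sum_congr rfl fun m hm => ?_
    rw [Finset.mem_range] at hm
    congr 2
    omega
  have hT' : (0 : ℝ) < 2 * T := by positivity
  have hr : ‖(((Real.sqrt (2 * T))⁻¹ : ℝ) : ℂ)‖ ^ 2 = (2 * T : ℝ)⁻¹ := by
    rw [Complex.norm_real, Real.norm_eq_abs, sq_abs, inv_pow, Real.sq_sqrt hT'.le]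
  rw [QueryAlgorithm.outputProb]
  have hq : (reflectionAlgorithm K hT).queries = T := rfl
  rw [hq, reflectionAlgorithm_state_final, hsum, EuclideanSpace.norm_sq_eq]
  refine (Fintype.sum_prod_type_right (γ := ℝ) (α₁ := Option X) (α₂ := Bool × Bool × Fin T) _).trans ?_
  set φ : Fin T → EuclideanSpace ℂ (Option X) := fun k =>
    (walkOperator K z)^[T - k] (EuclideanSpace.single none 1)
  have h : ∀ x v k, ‖Matrix.mulVec (uniformTest X hT :
      Matrix (QBasis X (Fin T)) (QBasis X (Fin T)) ℂ) (clockState φ) (x, v, true, k)‖ ^ 2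
      = (2 * T : ℝ)⁻¹ * ((T : ℝ)⁻¹ ^ 2 * ‖(∑ l, φ l) x‖ ^ 2) := by
    intro x v k
    rw [uniformTest_mulVec_clockState, norm_mul, norm_mul, norm_mul, mul_pow, mul_pow, mul_pow, hr,
      norm_inv, Complex.norm_natCast]
    cases v <;> simp
  simp only [Fintype.sum_prod_type, Fintype.sum_bool, if_true, Bool.false_eq_true, if_false,
    Finset.sum_const_zero, add_zero, h, ← Finset.mul_sum, Finset.sum_const, Finset.card_univ,
    Fintype.card_fin, nsmul_eq_mul]
  field_simp
  norm_num

/-- The witness conditions are those of a span program: `u` is a positive witness together with the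
coefficient of the target, and `y` is the image of a negative witness. -/
theorem reflectionAlgorithm_evaluates {T : ℕ} (hT : 0 < T) (D : Set (X → Bool))
    (f : (X → Bool) → Bool)
    (hpos : ∀ z ∈ D, f z = true → ∃ u ∈ K, (∀ x, z x = false → u (some x) = 0) ∧
      u none ≠ 0 ∧ 2 / 3 * ‖u‖ ^ 2 ≤ ‖u none‖ ^ 2)
    (hneg : ∀ z ∈ D, f z = false → ∃ y ∈ Kᗮ, (∀ x, z x = true → y (some x) = 0) ∧
      y none = 1 ∧ 3 * ‖y‖ ^ 2 ≤ T ^ 2) :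
    (reflectionAlgorithm K hT).Evaluates D f := by
  intro z hz
  have hT' : (0 : ℝ) < T := by exact_mod_cast hT
  cases hf : f z with
  | true =>
    obtain ⟨u, huK, hu, hu0, hu1⟩ := hpos z hz hf
    have hfix : walkOperator K z u = u := by
      have : availableReflection z u = u := by
        ext x
        rw [availableReflection_apply]
        cases x with
        | none => simp
        | some x => cases h : z x <;> simp [h, hu]
      rw [walkOperator, LinearIsometryEquiv.trans_apply, this,
        Submodule.reflection_mem_subspace_eq_self huK]
    have h := norm_inner_le_norm_sum_iterate _ hfix (EuclideanSpace.single none 1) T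
    rw [EuclideanSpace.inner_single_right, one_mul, RCLike.norm_conj] at h
    have hupos : 0 < ‖u‖ := norm_pos_iff.2 fun h0 => hu0 (by simp [h0])
    rw [reflectionAlgorithm_outputProb_true, le_div_iff₀ (by positivity)]
    have h2 := pow_le_pow_left₀ (by positivity) h 2
    rw [mul_pow, mul_pow] at h2
    have h3 : ‖u‖ ^ 2 * (2 / 3 * T ^ 2) ≤ ‖u‖ ^ 2 * ‖∑ m ∈ Finset.range T,
        (walkOperator K z)^[m + 1] (EuclideanSpace.single none 1)‖ ^ 2 := by
      refine le_trans ?_ h2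
      nlinarith [mul_le_mul_of_nonneg_left hu1 (sq_nonneg (T : ℝ))]
    exact le_of_mul_le_mul_left h3 (by positivity)
  | false =>
    obtain ⟨y, hyK, hy, hy0, hy1⟩ := hneg z hz hf
    -- the coboundary is taken at the image of `y` under the input reflection
    have hcob : (2 : ℂ) • EuclideanSpace.single none 1
        = availableReflection z y - walkOperator K z (availableReflection z y) := by
      have : availableReflection z (availableReflection z y) = y := by
        ext x
        rw [availableReflection_apply, availableReflection_apply]
        split_ifs <;> simp
      rw [walkOperator, LinearIsometryEquiv.trans_apply, this,
        Submodule.reflection_mem_subspace_orthogonalComplement_eq_neg hyK, sub_neg_eq_add]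
      ext x
      rw [PiLp.add_apply, availableReflection_apply]
      cases x with
      | none =>
        simp [hy0]
        norm_num
      | some x => cases h : z x <;> simp [h, hy]
    have h := norm_sum_iterate_le_of_coboundary _ hcob T
    rw [LinearIsometryEquiv.norm_map] at h
    have h2 := pow_le_pow_left₀ (norm_nonneg _) h 2
    have h3 : (reflectionAlgorithm K hT).outputProb z true ≤ 1 / 3 := by
      rw [reflectionAlgorithm_outputProb_true, div_le_iff₀ (by positivity)]
      linarith
    linarith [(reflectionAlgorithm K hT).outputProb_true_add_false z]

end Reflections

/-! ### Query algorithms from witnesses -/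

/-- Algorithms without queries compute the constant functions. -/
lemma exists_constant_queryAlgorithm (X : Type) [Fintype X] [DecidableEq X] (o : Bool) :
    ∃ A : QueryAlgorithm X, A.queries = 0 ∧ ∀ z, A.outputProb z o = 1 := by
  obtain ⟨M, hM⟩ := exists_unitary_mulVec_single (B := QBasis X Unit)
    (none, false, (false, ())) (Pi.single (none, false, (o, ())) 1) (by
      rw [Finset.sum_eq_single (none, false, (o, ()))]
      · simp
      · intro b _ hb
        simp [hb]
      · simp)
  refine ⟨{ S := Unit, start := (), queries := 0, U := fun _ => M }, rfl, fun z => ?_⟩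
  rw [QueryAlgorithm.outputProb, QueryAlgorithm.state, hM,
    Finset.sum_eq_single (none, false, (o, ()))]
  · simp
  · intro b _ hb
    simp [hb]
  · simp

section Witnesses

variable {X : Type} [Fintype X] {m : ℕ}

/-- The linear relations between the target `τ`, with index `none`, and the vectors `α • v x`, with
index `some x`. -/
noncomputable def relationSubmodule (τ : EuclideanSpace ℝ (Fin m))
    (v : X → EuclideanSpace ℝ (Fin m)) (α : ℝ) : Submodule ℂ (EuclideanSpace ℂ (Option X)) where
  carrier := {u | ∀ a, u none * (τ a : ℂ) + α * ∑ x, u (some x) * (v x a : ℂ) = 0}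
  zero_mem' := by simp
  add_mem' {u u'} hu hu' a := by
    have := congrArg₂ (· + ·) (hu a) (hu' a)
    simp only [add_zero] at this
    rw [← this]
    simp only [PiLp.add_apply, add_mul, Finset.sum_add_distrib]
    ring
  smul_mem' c u hu a := by
    have := congrArg (c * ·) (hu a)
    simp only [mul_zero] at this
    rw [← this]
    simp only [PiLp.smul_apply, smul_eq_mul, mul_assoc, ← Finset.mul_sum]
    ring

/-- A family `v` of vectors, each available when its variable is `1`, with a target `τ`, is a span
program. If the positive and negative witness sizes are at most `W₁` and `W₀`, then of the order of
`√(W₁ W₀)` queries suffice. -/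
theorem exists_queryAlgorithm_of_witnesses [DecidableEq X] (τ : EuclideanSpace ℝ (Fin m))
    (v : X → EuclideanSpace ℝ (Fin m)) (D : Set (X → Bool)) (f : (X → Bool) → Bool) {W₁ W₀ : ℝ}
    (hW₁ : 0 < W₁) {T : ℕ} (hT : 0 < T) (hTW : 3 * (1 + 2 * W₁ * W₀) ≤ T ^ 2)
    (hpos : ∀ z ∈ D, f z = true → ∃ w : X → ℝ, τ = ∑ x, w x • v x ∧
      (∀ x, z x = false → w x = 0) ∧ ∑ x, w x ^ 2 ≤ W₁)
    (hneg : ∀ z ∈ D, f z = false → ∃ h : EuclideanSpace ℝ (Fin m), inner ℝ τ h = 1 ∧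
      (∀ x, z x = true → inner ℝ (v x) h = 0) ∧ ∑ x, (inner ℝ (v x) h) ^ 2 ≤ W₀) :
    ∃ A : QueryAlgorithm X, A.queries = T ∧ A.Evaluates D f := by
  -- this scaling gives the dummy index weight at least `2/3` in the positive witnesses
  set α : ℝ := Real.sqrt (2 * W₁) with hα
  have hα2 : α ^ 2 = 2 * W₁ := Real.sq_sqrt (by positivity)
  have hα0 : 0 < α := Real.sqrt_pos.2 (by positivity)
  refine ⟨reflectionAlgorithm (relationSubmodule τ v α) hT, rfl,
    reflectionAlgorithm_evaluates _ hT D f (fun z hz hf => ?_) fun z hz hf => ?_⟩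
  · obtain ⟨w, hτ, hw, hwW⟩ := hpos z hz hf
    refine ⟨WithLp.toLp 2 fun x => x.elim (α : ℂ) fun x => -(w x : ℂ), fun a => ?_, fun x hx => ?_,
      ?_, ?_⟩
    · have : (τ a : ℂ) = ∑ x, (w x : ℂ) * (v x a : ℂ) := by
        rw [hτ]
        simp
      simp [this]
    · simp [hw x hx]
    · simpa using hα0.ne'
    · simp only [EuclideanSpace.norm_sq_eq, Fintype.sum_option, Option.elim, norm_neg,
        Complex.norm_real, Real.norm_eq_abs, sq_abs]
      linarith
  · obtain ⟨h, hτ, hv, hvW⟩ := hneg z hz hf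
    refine ⟨WithLp.toLp 2 fun x => x.elim (1 : ℂ) fun x => ((α * inner ℝ (v x) h : ℝ) : ℂ),
      fun u hu => ?_, fun x hx => ?_, ?_, ?_⟩
    · have hinner : ∀ y : EuclideanSpace ℝ (Fin m), inner ℝ y h = ∑ a, h a * y a := fun y => by
        simp [PiLp.inner_apply]
      have h1 : (∑ a, (h a : ℂ) * (τ a : ℂ)) = 1 := by
        rw [hinner] at hτ
        exact_mod_cast hτ
      have h2 : ∑ a, (h a : ℂ) *
          (u none * (τ a : ℂ) + α * ∑ x, u (some x) * (v x a : ℂ)) = 0 :=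
        Finset.sum_eq_zero fun a _ => by rw [hu a, mul_zero]
      have h3 : u none + ∑ x, α * (∑ a, (h a : ℂ) * (v x a : ℂ)) * u (some x) = 0 := by
        rw [← h2]
        simp only [mul_add, Finset.sum_add_distrib]
        congr 1
        · conv_lhs => rw [← mul_one (u none), ← h1, Finset.mul_sum]
          exact Finset.sum_congr rfl fun a _ => by ring
        · simp only [Finset.mul_sum, Finset.sum_mul]
          rw [Finset.sum_comm]
          exact Finset.sum_congr rfl fun a _ => Finset.sum_congr rfl fun x _ => by ring
      rw [← inner_conj_symm, map_eq_zero, PiLp.inner_apply, Fintype.sum_option]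
      refine Eq.trans ?_ h3
      congr 1
      · simp
      · refine Finset.sum_congr rfl fun x _ => ?_
        simp [hinner]
        ring
    · simp [hv x hx]
    · simp
    · simp only [EuclideanSpace.norm_sq_eq, Fintype.sum_option, Option.elim, norm_one,
        Complex.norm_real, Real.norm_eq_abs, sq_abs, mul_pow, ← Finset.mul_sum, hα2]
      nlinarith [mul_le_mul_of_nonneg_left hvW hW₁.le]

end Witnesses

namespace SpanProgram

variable {X : Type} {P : SpanProgram X} {z : X → Bool}

lemma IsPositiveWitness.accepts {w : P.I → ℝ} (h : P.IsPositiveWitness z w) : P.Accepts z := by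
  rw [Accepts, h.1]
  refine Submodule.sum_mem _ fun i _ => ?_
  by_cases hi : P.Available z i
  · exact Submodule.smul_mem _ _ (Submodule.subset_span ⟨i, hi, rfl⟩)
  · simp [h.2 i hi]

lemma IsNegativeWitness.not_accepts {w : EuclideanSpace ℝ (Fin P.dim)}
    (h : P.IsNegativeWitness z w) : ¬ P.Accepts z := by
  intro hz
  have hle : Submodule.span ℝ (P.vec '' {i | P.Available z i}) ≤ (Submodule.span ℝ {w})ᗮ := by
    rw [Submodule.span_le]
    rintro _ ⟨i, hi, rfl⟩
    rw [SetLike.mem_coe, Submodule.mem_orthogonal_singleton_iff_inner_left]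
    exact h.2 i hi
  have h0 := Submodule.mem_orthogonal_singleton_iff_inner_left.1 (hle hz)
  rw [h.1] at h0
  exact one_ne_zero h0

end SpanProgram

/-! ### The span program for `st`-connectivity -/

section Connectivity

variable {n : ℕ}

lemma inputGraph_adj {z : EdgeVar n → Bool} {u v : Fin n} :
    (inputGraph z).Adj u v ↔ ∃ h : ¬ s(u, v).IsDiag, z ⟨s(u, v), h⟩ = true := by
  rw [inputGraph, SimpleGraph.fromEdgeSet_adj]
  exact ⟨fun h => h.1, fun h => ⟨h, by simpa using h.1⟩⟩

/-- The signed incidence vector of a pair of vertices, oriented arbitrarily. -/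
noncomputable def edgeVector (e : EdgeVar n) : EuclideanSpace ℝ (Fin n) :=
  EuclideanSpace.single (Quot.out e.1).1 1 - EuclideanSpace.single (Quot.out e.1).2 1

lemma mk_out (e : EdgeVar n) : s((Quot.out e.1).1, (Quot.out e.1).2) = e.1 :=
  Quot.out_eq e.1

lemma inputGraph_adj_out {z : EdgeVar n → Bool} (e : EdgeVar n) :
    (inputGraph z).Adj (Quot.out e.1).1 (Quot.out e.1).2 ↔ z e = true := by
  rw [inputGraph_adj]
  simp only [mk_out]
  exact ⟨fun h => h.2, fun h => ⟨e.2, h⟩⟩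

lemma exists_sign_smul_edgeVector (u v : Fin n) (h : ¬ s(u, v).IsDiag) :
    ∃ σ : ℝ, σ ^ 2 = 1 ∧ σ • edgeVector ⟨s(u, v), h⟩
      = EuclideanSpace.single u 1 - EuclideanSpace.single v 1 := by
  rcases Sym2.eq_iff.1 (mk_out ⟨s(u, v), h⟩) with ⟨h1, h2⟩ | ⟨h1, h2⟩
  · exact ⟨1, one_pow 2, by rw [edgeVector, h1, h2, one_smul]⟩
  · exact ⟨-1, by norm_num, by rw [edgeVector, h1, h2, neg_one_smul, neg_sub]⟩

/-- A unit flow from `u` to `v` along a trail: each edge of the trail carries flow `±1`. -/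
lemma exists_flow_of_isTrail {G : SimpleGraph (Fin n)} {u v : Fin n} (p : G.Walk u v)
    (hp : p.IsTrail) : ∃ w : EdgeVar n → ℝ,
      EuclideanSpace.single u 1 - EuclideanSpace.single v 1 = ∑ e, w e • edgeVector e ∧
      (∀ e : EdgeVar n, e.1 ∉ p.edges → w e = 0) ∧ ∑ e, w e ^ 2 = p.length := by
  induction p with
  | nil => exact ⟨0, by simp, by simp, by simp⟩
  | @cons u v' v h p ih =>
    rw [SimpleGraph.Walk.isTrail_cons] at hp
    obtain ⟨w, hw, hw0, hwl⟩ := ih hp.1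
    have hd : ¬ s(u, v').IsDiag := by simpa using h.ne
    obtain ⟨σ, hσ, hσe⟩ := exists_sign_smul_edgeVector u v' hd
    have h0 : w ⟨s(u, v'), hd⟩ = 0 := hw0 _ hp.2
    refine ⟨fun e => w e + if e = ⟨s(u, v'), hd⟩ then σ else 0, ?_, fun e he => ?_, ?_⟩
    · simp [add_smul, Finset.sum_add_distrib, ite_smul, ← hw, hσe]
    · rw [SimpleGraph.Walk.edges_cons, List.mem_cons, not_or] at he
      have : e ≠ ⟨s(u, v'), hd⟩ := fun h => he.1 (congrArg Subtype.val h)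
      simp [hw0 e he.2, this]
    · have hsq : ∀ e, (w e + if e = ⟨s(u, v'), hd⟩ then σ else 0) ^ 2
          = w e ^ 2 + if e = ⟨s(u, v'), hd⟩ then 1 else 0 := by
        intro e
        split_ifs with he
        · rw [he, h0, zero_add, hσ]
          norm_num
        · simp
      simp [hsq, Finset.sum_add_distrib, hwl]

/-- The span program for `st`-connectivity. -/
noncomputable def stProgram (s t : Fin n) (hst : s ≠ t) : SpanProgram (EdgeVar n) where
  dim := n
  target := EuclideanSpace.single s 1 - EuclideanSpace.single t 1
  target_ne_zero h := by
    have := congrArg (fun x : EuclideanSpace ℝ (Fin n) => x s) h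
    simp [hst] at this
  I := EdgeVar n
  vec := edgeVector
  label e := (e, true)

lemma stProgram_exists_isPositiveWitness {s t : Fin n} (hst : s ≠ t) {d : ℕ}
    {z : EdgeVar n → Bool} (hz : z ∈ shortPathPromise s t d) (h : (inputGraph z).Reachable s t) :
    ∃ w : EdgeVar n → ℝ, (stProgram s t hst).IsPositiveWitness z w ∧ ∑ e, w e ^ 2 ≤ d := by
  obtain ⟨p, hp, hpd⟩ := hz h
  obtain ⟨w, hw, hw0, hwl⟩ := exists_flow_of_isTrail p hp.isTrail
  refine ⟨w, ⟨hw, fun (e : EdgeVar n) he => hw0 e fun hep => he ?_⟩, ?_⟩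
  · have hadj := p.edges_subset_edgeSet hep
    rw [← mk_out e, SimpleGraph.mem_edgeSet, inputGraph_adj_out] at hadj
    exact hadj
  · rw [hwl]
    exact_mod_cast hpd

/-- The witness is the indicator function of the connected component of `s`; each of the `n.choose 2`
input vectors contributes at most `1` to its size. -/
lemma stProgram_exists_isNegativeWitness {s t : Fin n} (hst : s ≠ t)
    {z : EdgeVar n → Bool} (h : ¬ (inputGraph z).Reachable s t) :
    ∃ w : EuclideanSpace ℝ (Fin n), (stProgram s t hst).IsNegativeWitness z w ∧
      ∑ e, (inner ℝ (edgeVector e) w) ^ 2 ≤ (n.choose 2 : ℕ) := by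
  classical
  set w : EuclideanSpace ℝ (Fin n) :=
    WithLp.toLp 2 fun a => if (inputGraph z).Reachable s a then 1 else 0 with hw
  have hin : ∀ a b : Fin n, inner ℝ (EuclideanSpace.single a 1 - EuclideanSpace.single b 1) w
      = w a - w b := fun a b => by
    rw [inner_sub_left, EuclideanSpace.inner_single_left, EuclideanSpace.inner_single_left]
    simp
  refine ⟨w, ⟨?_, fun (e : EdgeVar n) he => ?_⟩, ?_⟩
  · refine (hin s t).trans ?_
    simp [hw, h]
  · refine (hin _ _).trans ?_
    have hadj : (inputGraph z).Adj (Quot.out e.1).1 (Quot.out e.1).2 :=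
      (inputGraph_adj_out e).2 he
    have : (inputGraph z).Reachable s (Quot.out e.1).1 ↔
        (inputGraph z).Reachable s (Quot.out e.1).2 :=
      ⟨fun h => h.trans hadj.reachable, fun h => h.trans hadj.symm.reachable⟩
    simp [hw, this]
  · have hle : ∀ e : EdgeVar n, (inner ℝ (edgeVector e) w) ^ 2 ≤ 1 := fun e => by
      rw [edgeVector, hin]
      simp only [hw]
      split_ifs <;> norm_num
    refine (Finset.sum_le_sum fun e _ => hle e).trans ?_
    rw [Finset.sum_const, Finset.card_univ, nsmul_one, Sym2.card_subtype_not_diag, Fintype.card_fin]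

lemma stProgram_accepts_iff {s t : Fin n} (hst : s ≠ t) {d : ℕ} {z : EdgeVar n → Bool}
    (hz : z ∈ shortPathPromise s t d) :
    (stProgram s t hst).Accepts z ↔ (inputGraph z).Reachable s t := by
  refine ⟨fun ha => ?_, fun h => ?_⟩
  · by_contra h
    obtain ⟨w, hw, -⟩ := stProgram_exists_isNegativeWitness hst h
    exact hw.not_accepts ha
  · obtain ⟨w, hw, -⟩ := stProgram_exists_isPositiveWitness hst hz h
    exact hw.accepts

lemma stConnectivity_eq_true_iff {s t : Fin n} {z : EdgeVar n → Bool} :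
    stConnectivity s t z = true ↔ (inputGraph z).Reachable s t := by
  simp [stConnectivity]

lemma stConnectivity_eq_false_iff {s t : Fin n} {z : EdgeVar n → Bool} :
    stConnectivity s t z = false ↔ ¬ (inputGraph z).Reachable s t := by
  simp [stConnectivity]

lemma choose_two_le_sq (n : ℕ) : ((n.choose 2 : ℕ) : ℝ) ≤ (n : ℝ) ^ 2 := by
  exact_mod_cast Nat.choose_le_pow n 2

lemma exists_queryAlgorithm_stConnectivity (s t : Fin n) (d : ℕ) :
    ∃ A : QueryAlgorithm (EdgeVar n),
      A.Evaluates (shortPathPromise s t d) (stConnectivity s t) ∧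
      (A.queries : ℝ) ≤ 4 * Real.sqrt ((n.choose 2 : ℕ) * d) := by
  -- on a promise set where the function is constant no query is needed
  have hconst : ∀ o, (∀ z ∈ shortPathPromise s t d, stConnectivity s t z = o) →
      ∃ A : QueryAlgorithm (EdgeVar n),
        A.Evaluates (shortPathPromise s t d) (stConnectivity s t) ∧
        (A.queries : ℝ) ≤ 4 * Real.sqrt ((n.choose 2 : ℕ) * d) := by
    intro o ho
    obtain ⟨A, hA, hAo⟩ := exists_constant_queryAlgorithm (EdgeVar n) o
    refine ⟨A, fun z hz => ?_, ?_⟩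
    · rw [ho z hz, hAo]
      norm_num
    · rw [hA, Nat.cast_zero]
      positivity
  by_cases hst : s = t
  · refine hconst true fun z _ => ?_
    rw [stConnectivity_eq_true_iff, hst]
  rcases Nat.eq_zero_or_pos d with hd | hd
  · refine hconst false fun z hz => ?_
    rw [stConnectivity_eq_false_iff]
    intro h
    obtain ⟨p, -, hp⟩ := hz h
    exact hst (SimpleGraph.Walk.eq_of_length_eq_zero (p := p) (by omega))
  have hn : 2 ≤ n := by
    have := s.isLt
    have := t.isLt
    have : (s : ℕ) ≠ t := fun h => hst (Fin.ext h)
    omega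
  have hN : 0 < n.choose 2 := Nat.choose_pos hn
  have hd' : (1 : ℝ) ≤ d := by exact_mod_cast hd
  set R : ℝ := Real.sqrt ((n.choose 2 : ℕ) * d) with hR
  have hNd : (1 : ℝ) ≤ (n.choose 2 : ℕ) * d := by
    exact_mod_cast Nat.mul_pos hN hd
  have hR1 : 1 ≤ R := Real.one_le_sqrt.2 hNd
  have hR2 : R ^ 2 = (n.choose 2 : ℕ) * d := Real.sq_sqrt (by positivity)
  have hT1 : 3 * R ≤ (⌈3 * R⌉₊ : ℝ) := Nat.le_ceil _
  have hT2 : (⌈3 * R⌉₊ : ℝ) < 3 * R + 1 := Nat.ceil_lt_add_one (by positivity)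
  obtain ⟨A, hAT, hA⟩ := exists_queryAlgorithm_of_witnesses
    (EuclideanSpace.single s 1 - EuclideanSpace.single t 1) edgeVector (shortPathPromise s t d)
    (stConnectivity s t) (W₁ := d) (W₀ := (n.choose 2 : ℕ)) (T := ⌈3 * R⌉₊) (by linarith)
    (Nat.ceil_pos.2 (by positivity)) (by nlinarith)
    (fun z hz hf => by
      obtain ⟨w, hw, hwd⟩ :=
        stProgram_exists_isPositiveWitness hst hz (stConnectivity_eq_true_iff.1 hf)
      exact ⟨w, hw.1, fun e he => hw.2 e (by simp [SpanProgram.Available, stProgram, he]), hwd⟩)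
    fun z hz hf => by
      obtain ⟨w, hw, hwN⟩ :=
        stProgram_exists_isNegativeWitness hst (stConnectivity_eq_false_iff.1 hf)
      exact ⟨w, hw.1, fun e he => hw.2 e he, hwN⟩
  refine ⟨A, hA, ?_⟩
  rw [hAT]
  linarith

end Connectivity

theorem mainTheorem9 :
    ∃ C : ℝ, 0 < C ∧ ∀ (n : ℕ) (s t : Fin n) (d : ℕ),
      (∃ A : QueryAlgorithm (EdgeVar n),
        A.Evaluates (shortPathPromise s t d) (stConnectivity s t) ∧
        (A.queries : ℝ) ≤ C * (n * Real.sqrt d) ∧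
        (A.queries : ℝ) ≤ C * Real.sqrt ((n.choose 2 : ℕ) * d)) ∧
      (s ≠ t → ∃ P : SpanProgram (EdgeVar n),
        P.Evaluates (shortPathPromise s t d) (stConnectivity s t) ∧
        P.PositiveWitnessSizeLE (shortPathPromise s t d) d ∧
        P.NegativeWitnessSizeLE (shortPathPromise s t d) (C * (n : ℝ) ^ 2)) := by
  refine ⟨4, by norm_num, fun n s t d => ⟨?_, fun hst => ⟨stProgram s t hst, fun z hz => ?_,
    fun z hz ha => ?_, fun z hz ha => ?_⟩⟩⟩
  · obtain ⟨A, hA, hAq⟩ := exists_queryAlgorithm_stConnectivity s t d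
    refine ⟨A, hA, hAq.trans ?_, hAq⟩
    rw [Real.sqrt_mul (Nat.cast_nonneg _)]
    have := Real.sqrt_le_sqrt (choose_two_le_sq n)
    rw [Real.sqrt_sq (Nat.cast_nonneg _)] at this
    gcongr
  · rw [stProgram_accepts_iff hst hz, stConnectivity_eq_true_iff]
  · exact stProgram_exists_isPositiveWitness hst hz ((stProgram_accepts_iff hst hz).1 ha)
  · obtain ⟨w, hw, hwN⟩ := stProgram_exists_isNegativeWitness hst
      (fun h => ha ((stProgram_accepts_iff hst hz).2 h))
    refine ⟨w, hw, hwN.trans ((choose_two_le_sq n).trans ?_)⟩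
    nlinarith [sq_nonneg (n : ℝ)]
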